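/- For a commutative semigroup $(G,+)$ and a set of noncommuting variables $Z$, let $G[Z]$ denote the additive semigroup of formal polynomials in the variables $Z$ with coefficients from $G$: finite formal sums of monomials $c\,z_1z_2\cdots z_k$ with $c\in G$, $k\ge 0$ and $z_1,\dots,z_k\in Z$, where $c\,w+c'\,w=(c+c')\,w$ for every word $w$ in the variables. The empty sum, the zero polynomial $0$, is included; if $G$ has a zero $0_G$, then $0_G\,w=0$. A polynomial has no constant term if the empty word does not occur in it (that is, occurs with coefficient zero). A monomial with coefficient $c$ is evaluated at sums of variables by expanding, so that, e.g., $c\,x_1x_2$ at $x_i=\sum_{j\in\gamma}y_{i,j}$ is $\sum_{j,k\in\gamma}c\,y_{1,j}y_{2,k}$. **Proposition 7.3.** Let $r,q,n\in\mathbb N$, let $G$ be a commutative semigroup and let $p_1,\dots,p_q\in G[x_1,\dots,x_n]$ be polynomials without constant terms. There exist $N\in\mathbb N$ and a finite set $\mathcal Q\subset G[y_{1,1},\dots,y_{1,N},y_{2,1},\dots,y_{2,N},\dots,y_{n,1},\dots,y_{n,N}]$ of polynomials without constant terms such that for any $r$-coloring of $\mathcal Q$ there exist a nonempty $\gamma\subseteq\{1,\dots,N\}$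 and a polynomial $h\in\mathcal Q$ for which the polynomials $$h(y_{1,1},\dots,y_{n,N})+p_t\Bigl(\sum_{j\in\gamma}y_{1,j},\dots,\sum_{j\in\gamma}y_{n,j}\Bigr),\qquad t=1,\dots,q,$$ are all in $\mathcal Q$ and have the same color. -/

import Mathlib

noncomputable section

namespace NCPolynomial

/-- An element `x` of `G` with a zero adjoined is neutral if adding it changes no element of `G`.
The adjoined zero is always neutral; `(g : WithZero G)` is neutral iff `g` is a zero of `G`. -/
def IsNeutral {G : Type*} [AddCommSemigroup G] (x : WithZero G) : Prop :=
  ∀ g : G, x + (g : WithZero G) = (g : WithZero G)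

/-- The congruence on `WithZero G` identifying the adjoined zero with the zero of `G`,
if `G` happens to have one (and the trivial congruence otherwise). -/
def zeroCon (G : Type*) [AddCommSemigroup G] : AddCon (WithZero G) where
  r x y := x = y ∨ (IsNeutral x ∧ IsNeutral y)
  iseqv := by
    refine ⟨fun x => Or.inl rfl, ?_, ?_⟩
    · rintro x y (h | ⟨h, h'⟩)
      · exact Or.inl h.symm
      · exact Or.inr ⟨h', h⟩
    · rintro x y z (rfl | ⟨h, h'⟩) (rfl | ⟨k, k'⟩)
      · exact Or.inl rfl
      · exact Or.inr ⟨k, k'⟩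
      · exact Or.inr ⟨h, h'⟩
      · exact Or.inr ⟨h, k'⟩
  add' := by
    have key : ∀ a b c : WithZero G, IsNeutral b → IsNeutral c →
        a + b = a + c ∨ (IsNeutral (a + b) ∧ IsNeutral (a + c)) := by
      intro a b c hb hc
      induction a using WithZero.recZeroCoe with
      | zero => right; simpa using ⟨hb, hc⟩
      | coe g => left; rw [add_comm _ b, add_comm _ c, hb g, hc g]
    rintro w x y z (rfl | ⟨h, h'⟩) (rfl | ⟨k, k'⟩)
    · exact Or.inl rfl
    · exact key w y z k k'
    · rw [add_comm w, add_comm x]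
      exact key y w x h h'
    · right
      constructor
      · intro g; rw [add_assoc, k g, h g]
      · intro g; rw [add_assoc, k' g, h' g]

/-- The coefficients of formal polynomials over a commutative semigroup `G`: the elements of `G`,
together with a zero (the coefficient of an absent monomial), adjoined if `G` has none. -/
abbrev Coeff (G : Type*) [AddCommSemigroup G] : Type _ := (zeroCon G).Quotient

/-- The inclusion of `G` in `Coeff G`. -/
def Coeff.of {G : Type*} [AddCommSemigroup G] (g : G) : Coeff G :=
  ((g : WithZero G) : (zeroCon G).Quotient)

theorem Coeff.of_add {G : Type*} [AddCommSemigroup G] (g h : G) :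
    Coeff.of (g + h) = Coeff.of g + Coeff.of h := rfl

theorem Coeff.of_injective {G : Type*} [AddCommSemigroup G] :
    Function.Injective (Coeff.of : G → Coeff G) := by
  intro g h e
  rcases (AddCon.eq (zeroCon G)).1 e with e | ⟨hg, hh⟩
  · exact WithZero.coe_injective e
  · have h1 : g + h = h := WithZero.coe_injective (hg h)
    have h2 : h + g = g := WithZero.coe_injective (hh g)
    rw [← h2, add_comm, h1]

theorem Coeff.of_eq_zero_iff {G : Type*} [AddCommSemigroup G] (g : G) :
    Coeff.of g = 0 ↔ ∀ h : G, g + h = h := by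
  refine ⟨fun e h => ?_, fun H => (AddCon.eq (zeroCon G)).2 (Or.inr ⟨fun h => ?_, fun h => ?_⟩)⟩
  · rcases (AddCon.eq (zeroCon G)).1 e with e | ⟨hg, -⟩
    · exact absurd e (WithZero.coe_ne_zero)
    · exact WithZero.coe_injective (hg h)
  · exact congrArg _ (H h)
  · exact zero_add _

theorem Coeff.eq_zero_or_exists_of {G : Type*} [AddCommSemigroup G] (c : Coeff G) :
    c = 0 ∨ ∃ g : G, c = Coeff.of g := by
  induction c using AddCon.induction_on with
  | H x =>
    induction x using WithZero.recZeroCoe with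
    | zero => exact Or.inl rfl
    | coe g => exact Or.inr ⟨g, rfl⟩

end NCPolynomial

open NCPolynomial in
/-- The additive semigroup `G[σ]` of formal polynomials in noncommuting variables indexed by `σ`
with coefficients from the commutative semigroup `G`: finitely supported families of coefficients
indexed by the words in the variables, with coefficientwise addition. -/
abbrev NCPolynomial (G : Type*) [AddCommSemigroup G] (σ : Type*) : Type _ :=
  FreeMonoid σ →₀ Coeff G

namespace NCPolynomial

/-- A polynomial has no constant term if the coefficient of the empty word is zero. -/
def NoConstantTerm {G : Type*} [AddCommSemigroup G] {σ : Type*} (p : NCPolynomial G σ) : Prop :=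
  p (1 : FreeMonoid σ) = 0

/-- Polynomials in noncommuting variables indexed by `τ` with natural number coefficients;
these can be substituted for the variables of a polynomial over any commutative semigroup. -/
abbrev NatPoly (τ : Type*) : Type _ := MonoidAlgebra ℕ (FreeMonoid τ)

/-- The variable `y_i`, as a polynomial with natural number coefficients. -/
def natVar {τ : Type*} (i : τ) : NatPoly τ := MonoidAlgebra.of ℕ (FreeMonoid τ) (FreeMonoid.of i)

/-- For `c` a coefficient and `f = ∑ m_u u` with `m_u` natural numbers,
the polynomial `c f = ∑ (m_u c) u`. -/
def coeffMul {G : Type*} [AddCommSemigroup G] {τ : Type*} (c : Coeff G) (f : NatPoly τ) :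
    NCPolynomial G τ :=
  ∑ u ∈ f.coeff.support, Finsupp.single u (f.coeff u • c)

/-- Substitution `p(f_i : i ∈ σ)`: every monomial `c x_{i_1} ⋯ x_{i_k}` of `p` is replaced by
`c f_{i_1} ⋯ f_{i_k}`. -/
def subst {G : Type*} [AddCommSemigroup G] {σ τ : Type*} (p : NCPolynomial G σ)
    (f : σ → NatPoly τ) : NCPolynomial G τ :=
  ∑ w ∈ p.support, coeffMul (p w) (FreeMonoid.lift f w)

end NCPolynomial

end

/-!
Fix a sequence `e j` in a commutative monoid `V` and a finite set `S` of polynomial maps from `V` to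
an abelian group `A` that vanish at `0`. Every finite colouring of `A` admits a point `a` and a
nonempty finite sum `v` of the `e j` such that `a` and all `a + p v`, `p ∈ S`, have the same colour.
This is proved by Bergelson's PET induction and colour focusing: for `p₁ ∈ S` of least degree, the
maps `v ↦ p (u + v) - p u - p₁ v` form a system of smaller weight, whose recurrence allows one to
pass from a point `a` at which `s` colours are focused to a point `a - p₁ v` at which `s + 1`
colours are focused.

The polynomials over a semigroup `G` do not form a group. Replacing their coefficients by free
symbols with integer multiplicities turns substitution into a polynomial map with values in a group.
Translation by one large element then makes the finitely many points involved nonnegative, and the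
symbols can be evaluated in `G`.
-/

/-- The symmetric difference `v ↦ p (u + v) - p u - p v`, which measures the failure of `p` to be
additive in the direction `u`. -/
def crossDiff {V A : Type*} [Add V] [AddCommGroup A] (u : V) : (V → A) →+ (V → A) where
  toFun p v := p (u + v) - p u - p v
  map_zero' := by ext; simp
  map_add' p q := by ext; simp only [Pi.add_apply]; abel

@[simp]
theorem crossDiff_apply {V A : Type*} [Add V] [AddCommGroup A] (u : V) (p : V → A) (v : V) :
    crossDiff u p v = p (u + v) - p u - p v := rfl

/-- The maps `V → A` that vanish at zero and are polynomial of degree at most `d`. Working with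
`crossDiff` rather than with `v ↦ p (u + v) - p v` builds in that they vanish at zero. -/
def polyMaps (V A : Type*) [AddCommMonoid V] [AddCommGroup A] : ℕ → AddSubgroup (V → A)
  | 0 => ⊥
  | d + 1 => ⨅ u : V, (polyMaps V A d).comap (crossDiff u)

namespace polyMaps

variable {V A : Type*} [AddCommMonoid V] [AddCommGroup A]

theorem mem_zero {p : V → A} : p ∈ polyMaps V A 0 ↔ p = 0 := AddSubgroup.mem_bot

theorem mem_succ {d : ℕ} {p : V → A} :
    p ∈ polyMaps V A (d + 1) ↔ ∀ u, crossDiff u p ∈ polyMaps V A d := by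
  simp [polyMaps, AddSubgroup.mem_iInf]

theorem monotone : Monotone (polyMaps V A) := by
  refine monotone_nat_of_le_succ fun d => ?_
  induction d with
  | zero => exact bot_le
  | succ d ih => exact fun p hp => mem_succ.2 fun u => ih (mem_succ.1 hp u)

theorem crossDiff_mem {d : ℕ} {p : V → A} (hp : p ∈ polyMaps V A d) (u : V) :
    crossDiff u p ∈ polyMaps V A d :=
  mem_succ.1 (monotone d.le_succ hp) u

theorem map_zero {d : ℕ} {p : V → A} (hp : p ∈ polyMaps V A d) : p 0 = 0 := by
  induction d generalizing p with
  | zero => rw [mem_zero.1 hp, Pi.zero_apply]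
  | succ d ih => simpa using ih (mem_succ.1 hp 0)

theorem comp_mem {B : Type*} [AddCommGroup B] (g : A →+ B) {d : ℕ} {p : V → A}
    (hp : p ∈ polyMaps V A d) : g ∘ p ∈ polyMaps V B d := by
  induction d generalizing p with
  | zero => rw [mem_zero.1 hp, mem_zero]; ext; simp
  | succ d ih =>
    refine mem_succ.2 fun u => ?_
    have hcomp : crossDiff u (g ∘ p) = g ∘ crossDiff u p := by ext; simp
    exact hcomp ▸ ih (mem_succ.1 hp u)

theorem addMonoidHom_mem (g : V →+ A) : ⇑g ∈ polyMaps V A 1 :=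
  mem_succ.2 fun u => mem_zero.2 <| by ext; simp

theorem mul_mem {R : Type*} [Ring R] {a b : ℕ} {p q : V → R} (hp : p ∈ polyMaps V R a)
    (hq : q ∈ polyMaps V R b) : p * q ∈ polyMaps V R (a + b) := by
  match a, b with
  | 0, _ => rw [mem_zero.1 hp, zero_mul]; exact zero_mem _
  | _, 0 => rw [mem_zero.1 hq, mul_zero]; exact zero_mem _
  | a + 1, b + 1 =>
    refine (mem_succ (d := a + 1 + b)).2 fun u => ?_
    have hp' := mem_succ.1 hp u
    have hq' := mem_succ.1 hq u
    have hexp : crossDiff u (p * q) =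
        AddMonoidHom.mulLeft (p u) ∘ (q + crossDiff u q) +
        AddMonoidHom.mulRight (q u) ∘ (p + crossDiff u p) +
        (p * crossDiff u q + crossDiff u p * q + crossDiff u p * crossDiff u q) := by
      ext v
      simp only [crossDiff_apply, Pi.mul_apply, Pi.add_apply, Function.comp_apply,
        AddMonoidHom.coe_mulLeft, AddMonoidHom.coe_mulRight, add_sub_cancel]
      noncomm_ring
    rw [hexp]
    refine add_mem (add_mem ?_ ?_) (add_mem (add_mem ?_ ?_) ?_)
    · exact monotone (by omega) (comp_mem _ (add_mem hq (crossDiff_mem hq u)))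
    · exact monotone (by omega) (comp_mem _ (add_mem hp (crossDiff_mem hp u)))
    · exact monotone (by omega) (mul_mem hp hq')
    · exact monotone (by omega) (mul_mem hp' hq)
    · exact monotone (by omega) (mul_mem hp' hq')
termination_by a + b

theorem lift_mem {σ R : Type*} [Ring R] (l : σ → V →+ R) {w : FreeMonoid σ} (hw : w ≠ 1) :
    (fun v => FreeMonoid.lift (fun i => l i v) w) ∈ polyMaps V R w.length := by
  induction w using FreeMonoid.recOn with
  | one => exact absurd rfl hw
  | of_mul i w ih =>
    rcases eq_or_ne w 1 with rfl | hw'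
    · simp only [mul_one, FreeMonoid.lift_eval_of, FreeMonoid.length_of]
      exact addMonoidHom_mem (l i)
    · rw [FreeMonoid.length_mul, FreeMonoid.length_of]
      simp only [map_mul, FreeMonoid.lift_eval_of]
      exact mul_mem (addMonoidHom_mem (l i)) (ih hw')

theorem add_crossDiff_mem_iff {d : ℕ} {p : V → A} (hp : p ∈ polyMaps V A d) (u : V) (i : ℕ) :
    p + crossDiff u p ∈ polyMaps V A i ↔ p ∈ polyMaps V A i := by
  refine ⟨fun h => ?_, fun h => add_mem h (crossDiff_mem h u)⟩
  induction d with
  | zero => exact monotone (Nat.zero_le i) hp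
  | succ d ih =>
    rcases le_or_gt (d + 1) i with hdi | hid
    · exact monotone hdi hp
    · exact ih <| ((polyMaps V A d).add_mem_cancel_right (mem_succ.1 hp u)).1
        (monotone (Nat.le_of_lt_succ hid) h)

end polyMaps

section Focusing

variable {V A κ : Type*} [AddCommMonoid V]

/-- The colours `c` of the monochromatic configurations `{a + p v | p ∈ S}` based at `a`, where `v`
runs through the nonempty finite sums of `e 0, …, e (N - 1)`. -/
def focusedColors [Add A] (S : Set (V → A)) (e : ℕ → V) (N : ℕ) (χ : A → κ) (a : A) : Set κ :=
  {c | ∃ γ ⊆ Finset.range N, γ.Nonempty ∧ ∀ p ∈ S, χ (a + p (∑ j ∈ γ, e j)) = c}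

/-- Every finite colouring of `A` admits a point `a` and a nonempty finite sum `v` of terms of a
given sequence such that `a` and all `a + p v` with `p ∈ S` have the same colour, and `a` and `v`
can be found in a finite set that does not depend on the colouring. -/
def IsRecurrent [Add A] (S : Set (V → A)) : Prop :=
  ∀ (r : ℕ) (e : ℕ → V), ∃ (N : ℕ) (Q : Finset A), ∀ χ : A → Fin r,
    ∃ a ∈ Q, χ a ∈ focusedColors S e N χ a

theorem focusedColors_mono [Add A] (S : Set (V → A)) (e : ℕ → V) (χ : A → κ) (a : A) :
    Monotone fun N => focusedColors S e N χ a :=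
  fun _ _ hN _ ⟨γ, hγ, hc⟩ => ⟨γ, hγ.trans (Finset.range_mono hN), hc⟩

theorem focusedColors_comp_add_left [AddSemigroup A] (S : Set (V → A)) (e : ℕ → V) (N : ℕ)
    (χ : A → κ) (x a : A) :
    focusedColors S e N (fun b => χ (x + b)) a = focusedColors S e N χ (x + a) := by
  simp only [focusedColors, add_assoc]

/-- Taking `γ = ∅` in the hypothesis focuses the colour of `a` itself at `x`. -/
theorem insert_subset_focusedColors [AddZeroClass A] {S : Set (V → A)} (hS : ∀ p ∈ S, p 0 = 0)
    {e : ℕ → V} {χ : A → κ} {N N' : ℕ} {δ : Finset ℕ} (hδ : δ ⊆ Finset.range N')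
    (hδ₀ : δ.Nonempty) {a x : A}
    (h : ∀ p ∈ S, ∀ γ ⊆ Finset.range N,
      χ (x + p (∑ j ∈ γ, e j + ∑ j ∈ δ, e (N + j))) = χ (a + p (∑ j ∈ γ, e j))) :
    insert (χ a) (focusedColors S e N χ a) ⊆ focusedColors S e (N + N') χ x := by
  have hsum (γ) (hγ : γ ⊆ Finset.range N) :
      ∑ j ∈ γ ∪ δ.map (addLeftEmbedding N), e j = ∑ j ∈ γ, e j + ∑ j ∈ δ, e (N + j) := by
    rw [Finset.sum_union, Finset.sum_map]
    · rfl
    · exact (Finset.disjoint_range_addLeftEmbedding N δ).mono_left hγ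
  have hmem (γ) (hγ : γ ⊆ Finset.range N) :
      γ ∪ δ.map (addLeftEmbedding N) ⊆ Finset.range (N + N') := by
    rw [Finset.range_add]
    exact Finset.union_subset_union hγ (Finset.map_subset_map.2 hδ)
  have hnonempty (γ) : (γ ∪ δ.map (addLeftEmbedding N)).Nonempty :=
    (Finset.map_nonempty.2 hδ₀).mono Finset.subset_union_right
  rintro c (rfl | ⟨γ, hγ, -, hc⟩)
  · refine ⟨_, hmem ∅ (Finset.empty_subset _), hnonempty ∅, fun p hp => ?_⟩
    rw [hsum ∅ (Finset.empty_subset _), h p hp ∅ (Finset.empty_subset _), Finset.sum_empty, hS p hp,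
      add_zero]
  · exact ⟨_, hmem γ hγ, hnonempty γ, fun p hp => by rw [hsum γ hγ, h p hp γ hγ, hc p hp]⟩

end Focusing

/-- The system of maps `v ↦ p (u + v) - p u - p₁ v` to which the recurrence of `S` is reduced. -/
def derivedSystem {V A : Type*} [Add V] [AddCommGroup A] (S : Set (V → A)) (p₁ : V → A)
    (U : Set V) : Set (V → A) :=
  Set.image2 (fun p u => p + crossDiff u p - p₁) S U

namespace IsRecurrent

section General

variable {V A B : Type*} [AddCommMonoid V]

theorem exists_of_finite [Add A] {S : Set (V → A)} (h : IsRecurrent S) (κ : Type*) [Finite κ]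
    (e : ℕ → V) :
    ∃ (N : ℕ) (Q : Finset A), ∀ χ : A → κ, ∃ a ∈ Q, χ a ∈ focusedColors S e N χ a := by
  obtain ⟨r, ⟨φ⟩⟩ := Finite.exists_equiv_fin κ
  obtain ⟨N, Q, hQ⟩ := h r e
  refine ⟨N, Q, fun χ => ?_⟩
  obtain ⟨a, ha, γ, hγ, hγ₀, hc⟩ := hQ (φ ∘ χ)
  exact ⟨a, ha, γ, hγ, hγ₀, fun p hp => φ.injective (hc p hp)⟩

theorem exists_finset_coloring [Add A] {S : Set (V → A)} (h : IsRecurrent S) (hS : S.Finite)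
    (κ : Type*) [Finite κ] (e : ℕ → V) :
    ∃ (N : ℕ) (Q : Finset A), ∀ χ : Q → κ, ∃ γ ⊆ Finset.range N, γ.Nonempty ∧
      ∃ (a : A) (ha : a ∈ Q), ∀ p ∈ S, ∃ hp : a + p (∑ j ∈ γ, e j) ∈ Q,
        χ ⟨_, hp⟩ = χ ⟨a, ha⟩ := by
  classical
  obtain ⟨N, Q, hQ⟩ := h.exists_of_finite (Option κ) e
  let Q' := Q ∪ Finset.image₂ (fun a v => a + v) Q
    (Finset.image₂ (fun p γ => p (∑ j ∈ γ, e j)) hS.toFinset (Finset.range N).powerset)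
  refine ⟨N, Q', fun χ => ?_⟩
  obtain ⟨a, ha, γ, hγ, hγ₀, hc⟩ :=
    hQ (Function.extend Subtype.val (fun x => some (χ x)) fun _ => none)
  have ha' : a ∈ Q' := Finset.mem_union_left _ ha
  refine ⟨γ, hγ, hγ₀, a, ha', fun p hp => ?_⟩
  have hp' : a + p (∑ j ∈ γ, e j) ∈ Q' :=
    Finset.mem_union_right _ <| Finset.mem_image₂_of_mem ha <|
      Finset.mem_image₂_of_mem (hS.mem_toFinset.2 hp) (Finset.mem_powerset.2 hγ)
  have hcolor := hc p hp
  rw [Subtype.val_injective.extend_apply _ _ (⟨_, hp'⟩ : Q'),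
    Subtype.val_injective.extend_apply _ _ (⟨_, ha'⟩ : Q')] at hcolor
  exact ⟨hp', Option.some_injective _ hcolor⟩

theorem empty [AddZeroClass A] : IsRecurrent (∅ : Set (V → A)) := fun _ _ =>
  ⟨1, {0}, fun χ => ⟨0, Finset.mem_singleton_self 0, {0}, by simp⟩⟩

theorem of_diff_zero [AddZeroClass A] {S : Set (V → A)} (h : IsRecurrent (S \ {0})) :
    IsRecurrent S := by
  intro r e
  obtain ⟨N, Q, hQ⟩ := h r e
  refine ⟨N, Q, fun χ => ?_⟩
  obtain ⟨a, ha, γ, hγ, hγ₀, hc⟩ := hQ χ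
  refine ⟨a, ha, γ, hγ, hγ₀, fun p hp => ?_⟩
  rcases eq_or_ne p 0 with rfl | hp₀
  · rw [Pi.zero_apply, add_zero]
  · exact hc p ⟨hp, hp₀⟩

theorem map [AddZeroClass A] [AddZeroClass B] {S : Set (V → A)} (h : IsRecurrent S) (φ : A →+ B) :
    IsRecurrent ((φ ∘ ·) '' S) := by
  classical
  intro r e
  obtain ⟨N, Q, hQ⟩ := h r e
  refine ⟨N, Q.image φ, fun χ => ?_⟩
  obtain ⟨a, ha, γ, hγ, hγ₀, hc⟩ := hQ (χ ∘ φ)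
  refine ⟨φ a, Finset.mem_image_of_mem φ ha, γ, hγ, hγ₀, ?_⟩
  rintro _ ⟨p, hp, rfl⟩
  simpa only [Function.comp_apply, map_add] using hc p hp

end General

section Derived

variable {V A : Type*} [AddCommMonoid V] [AddCommGroup A]

/-- The recurrence of the derived system is applied to the product colouring that records the
colours of all the points `a + b + p (∑ j ∈ γ, e j)`. -/
theorem exists_color_shift_eq {S : Set (V → A)} (hS : S.Finite) {p₁ : V → A}
    (h : ∀ U : Set V, U.Finite → IsRecurrent (derivedSystem S p₁ U))
    (κ : Type*) [Finite κ] (e : ℕ → V) (N : ℕ) (Q : Finset A) :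
    ∃ (N' : ℕ) (Q' : Finset A), ∀ χ : A → κ, ∃ a ∈ Q', ∃ δ ⊆ Finset.range N', δ.Nonempty ∧
      ∀ b ∈ Q, ∀ p ∈ S, ∀ γ ⊆ Finset.range N,
        χ (a + b - p₁ (∑ j ∈ δ, e (N + j)) + p (∑ j ∈ γ, e j + ∑ j ∈ δ, e (N + j))) =
          χ (a + b + p (∑ j ∈ γ, e j)) := by
  classical
  let U : Finset V := (Finset.range N).powerset.image fun γ => ∑ j ∈ γ, e j
  let B : Finset A := Finset.image₂ (fun b x => b + x) Q
    (Finset.image₂ (fun p u => p u) hS.toFinset U)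
  obtain ⟨N', Q', hQ'⟩ := (h U U.finite_toSet).exists_of_finite (B → κ) fun j => e (N + j)
  refine ⟨N', Q', fun χ => ?_⟩
  obtain ⟨a, ha, δ, hδ, hδ₀, hχ⟩ := hQ' fun a b => χ (a + b)
  refine ⟨a, ha, δ, hδ, hδ₀, fun b hb p hp γ hγ => ?_⟩
  have hu : ∑ j ∈ γ, e j ∈ U := Finset.mem_image_of_mem _ (Finset.mem_powerset.2 hγ)
  have hB : b + p (∑ j ∈ γ, e j) ∈ B :=
    Finset.mem_image₂_of_mem hb (Finset.mem_image₂_of_mem (hS.mem_toFinset.2 hp) hu)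
  convert congrFun (hχ _ (Set.mem_image2_of_mem hp hu)) ⟨_, hB⟩ using 2
  · simp only [Pi.sub_apply, Pi.add_apply, crossDiff_apply]
    abel
  · exact add_assoc _ _ _

/-- Colour focusing: passing from `a` to `a - p₁ v` keeps all colours focused at `a` and adds the
colour of `a` itself to them. -/
theorem exists_mem_or_le_ncard_focusedColors {S : Set (V → A)} (hS : S.Finite)
    (hS₀ : ∀ p ∈ S, p 0 = 0) {p₁ : V → A}
    (h : ∀ U : Set V, U.Finite → IsRecurrent (derivedSystem S p₁ U))
    (κ : Type*) [Finite κ] (e : ℕ → V) (s : ℕ) :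
    ∃ (N : ℕ) (Q : Finset A), ∀ χ : A → κ, ∃ a ∈ Q,
      χ a ∈ focusedColors S e N χ a ∨ s ≤ (focusedColors S e N χ a).ncard := by
  classical
  induction s with
  | zero => exact ⟨0, {0}, fun χ => ⟨0, Finset.mem_singleton_self 0, Or.inr (Nat.zero_le _)⟩⟩
  | succ s ih =>
    obtain ⟨N, Q, hQ⟩ := ih
    obtain ⟨N', Q', hQ'⟩ := exists_color_shift_eq hS h κ e N Q
    let Q₁ : Finset A := Finset.image₂ (fun a b => a + b) Q' Q
    refine ⟨N + N', Q₁ ∪ Finset.image₂ (fun a δ => a - p₁ (∑ j ∈ δ, e (N + j))) Q₁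
      (Finset.range N').powerset, fun χ => ?_⟩
    obtain ⟨a, ha, δ, hδ, hδ₀, hχ⟩ := hQ' χ
    obtain ⟨b, hb, hfoc⟩ := hQ fun b => χ (a + b)
    have hab : a + b ∈ Q₁ := Finset.mem_image₂_of_mem ha hb
    rw [focusedColors_comp_add_left] at hfoc
    by_cases hmem : χ (a + b) ∈ focusedColors S e N χ (a + b)
    · exact ⟨a + b, Finset.mem_union_left _ hab,
        Or.inl (focusedColors_mono S e χ (a + b) (N.le_add_right N') hmem)⟩
    refine ⟨a + b - p₁ (∑ j ∈ δ, e (N + j)), Finset.mem_union_right _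
      (Finset.mem_image₂_of_mem hab (Finset.mem_powerset.2 hδ)), Or.inr ?_⟩
    calc s + 1 ≤ (insert (χ (a + b)) (focusedColors S e N χ (a + b))).ncard := by
          rw [Set.ncard_insert_of_notMem hmem]
          exact Nat.succ_le_succ (hfoc.resolve_left hmem)
      _ ≤ _ := Set.ncard_le_ncard (insert_subset_focusedColors hS₀ hδ hδ₀ (hχ b hb))

theorem of_derivedSystem {S : Set (V → A)} (hS : S.Finite) (hS₀ : ∀ p ∈ S, p 0 = 0) {p₁ : V → A}
    (h : ∀ U : Set V, U.Finite → IsRecurrent (derivedSystem S p₁ U)) : IsRecurrent S := by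
  intro r e
  obtain ⟨N, Q, hQ⟩ := exists_mem_or_le_ncard_focusedColors hS hS₀ h (Fin r) e (r + 1)
  refine ⟨N, Q, fun χ => ?_⟩
  obtain ⟨a, ha, hmem | hcard⟩ := hQ χ
  · exact ⟨a, ha, hmem⟩
  · have hle := Set.ncard_le_card (focusedColors S e N χ a)
    rw [Nat.card_fin] at hle
    omega

end Derived

end IsRecurrent

section Weight

variable {V A : Type*} [AddCommMonoid V] [AddCommGroup A]

/-- The leading parts of the members of `S` of degree exactly `i + 1`, that is, their classes
modulo the maps of degree at most `i`. -/
def leadingClasses (S : Set (V → A)) (i : ℕ) : Set ((V → A) ⧸ polyMaps V A i) :=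
  QuotientAddGroup.mk '' {p ∈ S | p ∈ polyMaps V A (i + 1) ∧ p ∉ polyMaps V A i}

/-- The weight of a system of maps of degree at most `D` in Bergelson's PET induction: the numbers
of its leading parts of each degree, the highest degree being the most significant. -/
noncomputable def petWeight (D : ℕ) (S : Set (V → A)) : Colex (Fin D → ℕ) :=
  toColex fun i => (leadingClasses S i).ncard

theorem finite_leadingClasses {S : Set (V → A)} (hS : S.Finite) (i : ℕ) :
    (leadingClasses S i).Finite :=
  (hS.sep _).image _

theorem petWeight_mono {D : ℕ} {S T : Set (V → A)} (hT : T.Finite) (hST : S ⊆ T) :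
    petWeight D S ≤ petWeight D T :=
  Pi.toColex_monotone fun i => Set.ncard_le_ncard
    (Set.image_mono fun _ hp => ⟨hST hp.1, hp.2⟩) (finite_leadingClasses hT i)

theorem toColex_lt_toColex {ι β : Type*} [LinearOrder ι] [WellFoundedGT ι] [PartialOrder β]
    {x y : ι → β} {k : ι} (hk : x k < y k) (hle : ∀ i > k, x i ≤ y i) :
    toColex x < toColex y := by
  let z : ι → β := fun i => if i ≤ k then y i else x i
  have hxz : toColex x < toColex z :=
    ⟨k, fun j hj => (if_neg hj.not_ge).symm, hk.trans_eq (if_pos le_rfl).symm⟩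
  refine hxz.trans_le (Pi.toColex_monotone fun i => ?_)
  rcases le_or_gt i k with hi | hi
  · exact (if_pos hi).le
  · exact (if_neg hi.not_ge).trans_le (hle i hi)

variable {S : Set (V → A)} {D k : ℕ} {p₁ : V → A} {U : Set V}

theorem exists_mem_polyMaps_succ (hS : S.Nonempty) (hS₀ : 0 ∉ S)
    (hD : ∀ p ∈ S, p ∈ polyMaps V A D) :
    ∃ k, (∃ p ∈ S, p ∈ polyMaps V A (k + 1)) ∧ ∀ p ∈ S, p ∉ polyMaps V A k := by
  classical
  have hex : ∃ d, ∃ p ∈ S, p ∈ polyMaps V A d := ⟨D, hS.imp fun p hp => ⟨hp, hD p hp⟩⟩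
  obtain ⟨k, hk⟩ : ∃ k, Nat.find hex = k + 1 := by
    refine Nat.exists_eq_succ_of_ne_zero fun h => hS₀ ?_
    obtain ⟨p, hp, hp₀⟩ := (Nat.find_eq_zero hex).1 h
    exact polyMaps.mem_zero.1 hp₀ ▸ hp
  exact ⟨k, hk ▸ Nat.find_spec hex,
    fun p hp hpk => Nat.find_min hex (hk ▸ k.lt_succ_self) ⟨p, hp, hpk⟩⟩

theorem add_crossDiff_sub_mem_iff {p : V → A} (hp : p ∈ polyMaps V A D) (u : V) {i : ℕ}
    (hp₁ : p₁ ∈ polyMaps V A i) : p + crossDiff u p - p₁ ∈ polyMaps V A i ↔ p ∈ polyMaps V A i := by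
  rw [sub_eq_add_neg, AddSubgroup.add_mem_cancel_right _ (neg_mem hp₁),
    polyMaps.add_crossDiff_mem_iff hp]

theorem mk_add_crossDiff_sub {p : V → A} {i : ℕ} (hp : p ∈ polyMaps V A (i + 1)) (u : V) :
    (QuotientAddGroup.mk (p + crossDiff u p - p₁) : (V → A) ⧸ polyMaps V A i) =
      QuotientAddGroup.mk p - QuotientAddGroup.mk p₁ := by
  rw [QuotientAddGroup.mk_sub, QuotientAddGroup.mk_add,
    (QuotientAddGroup.eq_zero_iff _).2 (polyMaps.mem_succ.1 hp u), add_zero]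

theorem leadingClasses_derivedSystem_subset {i : ℕ} (hD : ∀ p ∈ S, p ∈ polyMaps V A D)
    (hp₁ : p₁ ∈ polyMaps V A i) : leadingClasses (derivedSystem S p₁ U) i ⊆ leadingClasses S i := by
  rintro _ ⟨_, ⟨⟨p, hp, u, -, rfl⟩, hmem, hnot⟩, rfl⟩
  have hmem' := (add_crossDiff_sub_mem_iff (hD p hp) u (polyMaps.monotone i.le_succ hp₁)).1 hmem
  refine ⟨p, ⟨hp, hmem', mt (add_crossDiff_sub_mem_iff (hD p hp) u hp₁).2 hnot⟩, ?_⟩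
  rw [mk_add_crossDiff_sub hmem', (QuotientAddGroup.eq_zero_iff p₁).2 hp₁, sub_zero]

theorem leadingClasses_derivedSystem_subset_image_sub (hD : ∀ p ∈ S, p ∈ polyMaps V A D)
    (hS : ∀ p ∈ S, p ∉ polyMaps V A k) (hp₁ : p₁ ∈ polyMaps V A (k + 1)) :
    leadingClasses (derivedSystem S p₁ U) k ⊆
      (fun x => x - QuotientAddGroup.mk p₁) '' (leadingClasses S k \ {QuotientAddGroup.mk p₁}) := by
  rintro _ ⟨_, ⟨⟨p, hp, u, -, rfl⟩, hmem, hnot⟩, rfl⟩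
  have hmem' := (add_crossDiff_sub_mem_iff (hD p hp) u hp₁).1 hmem
  refine ⟨QuotientAddGroup.mk p, ⟨⟨p, ⟨hp, hmem', hS p hp⟩, rfl⟩, fun hpp₁ => hnot ?_⟩,
    (mk_add_crossDiff_sub hmem' u).symm⟩
  rw [← QuotientAddGroup.eq_zero_iff, mk_add_crossDiff_sub hmem', sub_eq_zero]
  exact hpp₁

theorem petWeight_derivedSystem_lt (hfin : S.Finite) (hD : ∀ p ∈ S, p ∈ polyMaps V A D)
    (hS : ∀ p ∈ S, p ∉ polyMaps V A k) (hp₁S : p₁ ∈ S) (hp₁ : p₁ ∈ polyMaps V A (k + 1)) :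
    petWeight D (derivedSystem S p₁ U) < petWeight D S := by
  have hkD : k < D := not_le.1 fun hDk => hS p₁ hp₁S (polyMaps.monotone hDk (hD p₁ hp₁S))
  refine toColex_lt_toColex (k := ⟨k, hkD⟩) ?_ fun i hi => Set.ncard_le_ncard
    (leadingClasses_derivedSystem_subset hD (polyMaps.monotone (Nat.succ_le_of_lt hi) hp₁))
    (finite_leadingClasses hfin i)
  have hlead := finite_leadingClasses hfin k
  calc (leadingClasses (derivedSystem S p₁ U) k).ncard
      ≤ ((fun x => x - QuotientAddGroup.mk p₁) ''
          (leadingClasses S k \ {QuotientAddGroup.mk p₁})).ncard :=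
        Set.ncard_le_ncard (leadingClasses_derivedSystem_subset_image_sub hD hS hp₁)
          (hlead.sdiff.image _)
    _ ≤ (leadingClasses S k \ {QuotientAddGroup.mk p₁}).ncard := Set.ncard_image_le hlead.sdiff
    _ < (leadingClasses S k).ncard :=
        Set.ncard_sdiff_singleton_lt_of_mem ⟨p₁, ⟨hp₁S, hp₁, hS p₁ hp₁S⟩, rfl⟩ hlead

end Weight

theorem isRecurrent_of_forall_mem_polyMaps {V A : Type*} [AddCommMonoid V] [AddCommGroup A]
    {D : ℕ} {S : Set (V → A)} (hS : S.Finite) (hD : ∀ p ∈ S, p ∈ polyMaps V A D) :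
    IsRecurrent S := by
  induction hw : petWeight D S using WellFoundedLT.induction generalizing S with
  | ind w ih =>
  subst hw
  have hS' : (S \ {0}).Finite := hS.sdiff
  have hD' : ∀ p ∈ S \ {0}, p ∈ polyMaps V A D := fun p hp => hD p hp.1
  refine IsRecurrent.of_diff_zero ?_
  rcases (S \ {0}).eq_empty_or_nonempty with hempty | hne
  · exact hempty ▸ IsRecurrent.empty
  obtain ⟨k, ⟨p₁, hp₁S, hp₁⟩, hmin⟩ := exists_mem_polyMaps_succ hne (fun h => h.2 rfl) hD'
  refine .of_derivedSystem (p₁ := p₁) hS' (fun p hp => polyMaps.map_zero (hD' p hp)) fun U hU => ?_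
  refine ih _ ?_ (hS'.image2 _ hU) ?_ rfl
  · exact (petWeight_derivedSystem_lt hS' hD' hmin hp₁S hp₁).trans_le
      (petWeight_mono hS Set.sdiff_subset)
  · rintro _ ⟨p, hp, u, -, rfl⟩
    exact (add_crossDiff_sub_mem_iff (hD' p hp) u (hD' p₁ hp₁S)).2 (hD' p hp)

section Differences

variable {M A : Type*} [AddCommMonoid M] [AddCommGroup A]

theorem exists_forall_add_mem_range {ι : M →+ A} (hι : ∀ a, ∃ m m', a = ι m - ι m')
    (Q : Finset A) : ∃ b, ∀ a ∈ Q, a + ι b ∈ Set.range ι := by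
  classical
  choose m m' hm using hι
  refine ⟨∑ a ∈ Q, m' a, fun a ha => ⟨m a + ∑ x ∈ Q.erase a, m' x, ?_⟩⟩
  rw [← Finset.add_sum_erase Q m' ha, map_add, map_add, ← add_assoc,
    ← sub_add_cancel (ι (m a)) (ι (m' a)), ← hm a]

theorem exists_eq_mapRange_sub {ι : M →+ A} (hι : ∀ a, ∃ m m', a = ι m - ι m')
    {X : Type*} (a : X →₀ A) :
    ∃ m m', a = Finsupp.mapRange.addMonoidHom ι m - Finsupp.mapRange.addMonoidHom ι m' := by
  induction a using Finsupp.induction_linear with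
  | zero => exact ⟨0, 0, by simp⟩
  | add a b ha hb =>
    obtain ⟨m, m', rfl⟩ := ha
    obtain ⟨l, l', rfl⟩ := hb
    exact ⟨m + l, m' + l', by rw [map_add, map_add]; abel⟩
  | single x a =>
    obtain ⟨m, m', rfl⟩ := hι a
    exact ⟨Finsupp.single x m, Finsupp.single x m', by simp [Finsupp.single_sub]⟩

theorem exists_eq_mapRingHom_sub {X : Type*} [Monoid X] (a : MonoidAlgebra ℤ X) :
    ∃ m m', a = MonoidAlgebra.mapRingHom X (Nat.castRingHom ℤ) m -
      MonoidAlgebra.mapRingHom X (Nat.castRingHom ℤ) m' := by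
  have hint (k : ℤ) : ∃ m m', k = Nat.castAddMonoidHom ℤ m - Nat.castAddMonoidHom ℤ m' :=
    ⟨k.toNat, (-k).toNat, (Int.toNat_sub_toNat_neg k).symm⟩
  obtain ⟨m, m', h⟩ := exists_eq_mapRange_sub hint a.coeff
  exact ⟨.ofCoeff m, .ofCoeff m', MonoidAlgebra.coeff_injective h⟩

/-- A finite set witnessing recurrence over `A` is moved into the image of `M` by a single
translation. -/
theorem IsRecurrent.of_comp_injective {V : Type*} [AddCommMonoid V] {ι : M →+ A}
    (hinj : Function.Injective ι) (hι : ∀ a, ∃ m m', a = ι m - ι m') {S : Set (V → M)}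
    (h : IsRecurrent ((ι ∘ ·) '' S)) : IsRecurrent S := by
  classical
  intro r e
  obtain ⟨N, Q, hQ⟩ := h r e
  obtain ⟨b, hb⟩ := exists_forall_add_mem_range hι Q
  choose! g hg using hb
  refine ⟨N, Q.image g, fun χ => ?_⟩
  obtain ⟨a, ha, γ, hγ, hγ₀, hc⟩ := hQ fun a => χ (Function.invFun ι (a + ι b))
  refine ⟨g a, Finset.mem_image_of_mem g ha, γ, hγ, hγ₀, fun p hp => ?_⟩
  simpa only [Function.comp_apply, add_right_comm, ← hg a ha, ← map_add,
    Function.leftInverse_invFun hinj _] using hc _ ⟨p, hp, rfl⟩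

end Differences

namespace NCPolynomial

variable {G σ τ : Type*} [AddCommSemigroup G]

/-- Multiplication of a fixed coefficient with polynomials over `ℕ`, as an additive map. -/
noncomputable def coeffMulHom (c : Coeff G) : NatPoly τ →+ NCPolynomial G τ :=
  (Finsupp.mapRange.addMonoidHom (multiplesHom (Coeff G) c)).comp
    MonoidAlgebra.coeffAddEquiv.toAddMonoidHom

theorem coeffMulHom_apply (c : Coeff G) (f : NatPoly τ) (u : FreeMonoid τ) :
    coeffMulHom c f u = f.coeff u • c := rfl

theorem coeffMul_eq_coeffMulHom (c : Coeff G) (f : NatPoly τ) : coeffMul c f = coeffMulHom c f := by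
  classical
  ext u
  rw [coeffMul, Finsupp.finsetSum_apply, coeffMulHom_apply]
  simp only [Finsupp.single_apply, Finset.sum_ite_eq', Finsupp.mem_support_iff, ite_eq_left_iff,
    not_not]
  intro h
  rw [h, zero_nsmul]

/-- The free commutative monoid on the monomials `c w`, in which no sums of coefficients are carried
out. Unlike `NCPolynomial G τ` it is cancellative, and so embeds in its group of differences. -/
abbrev FormalPoly (G τ : Type*) [AddCommSemigroup G] : Type _ := Coeff G →₀ NatPoly τ

/-- Adding up the monomials of a formal polynomial in `NCPolynomial G τ`. -/
noncomputable def FormalPoly.eval : FormalPoly G τ →+ NCPolynomial G τ :=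
  Finsupp.liftAddHom (N := NCPolynomial G τ) coeffMulHom

/-- The substitution `p.subst` before the coefficients of equal words are added up in `G`. -/
noncomputable def formalSubst (p : NCPolynomial G σ) (f : σ → NatPoly τ) : FormalPoly G τ :=
  ∑ w ∈ p.support, Finsupp.single (p w) (FreeMonoid.lift f w)

theorem eval_formalSubst (p : NCPolynomial G σ) (f : σ → NatPoly τ) :
    (p.formalSubst f).eval = p.subst f := by
  simp only [formalSubst, FormalPoly.eval, subst, map_sum, Finsupp.liftAddHom_apply_single,
    coeffMul_eq_coeffMulHom]

/-- The inclusion of formal polynomials in the group of their differences. -/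
noncomputable def FormalPoly.toInt :
    FormalPoly G τ →+ (Coeff G →₀ MonoidAlgebra ℤ (FreeMonoid τ)) :=
  Finsupp.mapRange.addMonoidHom (MonoidAlgebra.mapRingHom _ (Nat.castRingHom ℤ)).toAddMonoidHom

theorem FormalPoly.toInt_injective : Function.Injective (toInt (G := G) (τ := τ)) :=
  Finsupp.mapRange_injective _ (map_zero _)
    (MonoidAlgebra.map_injective (Nat.castAddMonoidHom ℤ) Nat.cast_injective)

theorem FormalPoly.exists_eq_toInt_sub (a : Coeff G →₀ MonoidAlgebra ℤ (FreeMonoid τ)) :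
    ∃ m m', a = toInt m - toInt m' :=
  exists_eq_mapRange_sub exists_eq_mapRingHom_sub a

theorem toInt_formalSubst_mem_polyMaps {p : NCPolynomial G σ} (hp : p.NoConstantTerm) :
    (fun f : σ → NatPoly τ => (p.formalSubst f).toInt) ∈
      polyMaps _ _ (p.support.sup FreeMonoid.length) := by
  let ψ := MonoidAlgebra.mapRingHom (FreeMonoid τ) (Nat.castRingHom ℤ)
  have hsum : (fun f : σ → NatPoly τ => (p.formalSubst f).toInt) =
      ∑ w ∈ p.support, Finsupp.singleAddHom (p w) ∘
        fun f => FreeMonoid.lift (fun i => ψ (f i)) w := by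
    ext1 f
    simp only [FormalPoly.toInt, formalSubst, Finset.sum_apply, map_sum,
      Finsupp.mapRange.addMonoidHom_apply, Finsupp.mapRange_single, Function.comp_apply]
    exact Finset.sum_congr rfl fun w _ => congrArg _ <| FreeMonoid.hom_map_lift ψ.toMonoidHom f w
  rw [hsum]
  refine sum_mem fun w hw => polyMaps.comp_mem _ (polyMaps.monotone (Finset.le_sup hw) ?_)
  refine polyMaps.lift_mem (fun i => ψ.toAddMonoidHom.comp (Pi.evalAddMonoidHom _ i)) ?_
  rintro rfl
  exact Finsupp.mem_support_iff.1 hw hp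

theorem isRecurrent_subst (τ : Type*) {ι : Type*} [Finite ι] {p : ι → NCPolynomial G σ}
    (hp : ∀ t, (p t).NoConstantTerm) :
    IsRecurrent (Set.range fun t (f : σ → NatPoly τ) => (p t).subst f) := by
  have hformal : IsRecurrent (Set.range fun t (f : σ → NatPoly τ) => (p t).formalSubst f) := by
    refine .of_comp_injective FormalPoly.toInt_injective FormalPoly.exists_eq_toInt_sub ?_
    obtain ⟨D, hD⟩ := (Set.finite_range fun t => (p t).support.sup FreeMonoid.length).bddAbove
    refine isRecurrent_of_forall_mem_polyMaps (D := D) ((Set.finite_range _).image _) ?_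
    rintro _ ⟨_, ⟨t, rfl⟩, rfl⟩
    exact polyMaps.monotone (hD ⟨t, rfl⟩) (toInt_formalSubst_mem_polyMaps (hp t))
  simpa only [← Set.range_comp, Function.comp_def, eval_formalSubst] using
    hformal.map FormalPoly.eval

/-- Renaming of the variables, used to pass from the variables `(i, j)` with `j : ℕ` to finitely
many. -/
noncomputable def rename (g : σ → τ) : NCPolynomial G σ →+ NCPolynomial G τ :=
  Finsupp.mapDomain.addMonoidHom (FreeMonoid.map g)

theorem rename_subst {υ : Type*} (g : τ → υ) (p : NCPolynomial G σ) (f : σ → NatPoly τ) :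
    rename g (p.subst f) =
      p.subst fun i => MonoidAlgebra.mapDomainRingHom ℕ (FreeMonoid.map g) (f i) := by
  have hcoeff (c : Coeff G) (f : NatPoly τ) : rename g (coeffMulHom c f) =
      coeffMulHom c (MonoidAlgebra.mapDomainRingHom ℕ (FreeMonoid.map g) f) :=
    Finsupp.mapDomain_mapRange _ _ _ (map_zero _) (map_add _)
  simp only [subst, map_sum, coeffMul_eq_coeffMulHom, hcoeff]
  exact Finset.sum_congr rfl fun w _ => congrArg _ <|
    FreeMonoid.hom_map_lift (MonoidAlgebra.mapDomainRingHom ℕ (FreeMonoid.map g)).toMonoidHom f w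

theorem mapDomainRingHom_natVar (g : σ → τ) (i : σ) :
    MonoidAlgebra.mapDomainRingHom ℕ (FreeMonoid.map g) (natVar i) = natVar (g i) := by
  simp [natVar]

theorem coeff_one_mul {R : Type*} [Semiring R] (f g : MonoidAlgebra R (FreeMonoid τ)) :
    (f * g).coeff 1 = f.coeff 1 * g.coeff 1 := by
  rw [MonoidAlgebra.coeff_mul_antidiag f g 1 {(1, 1)}, Finset.sum_singleton]
  rintro ⟨u, v⟩
  simp

theorem NoConstantTerm.subst {p : NCPolynomial G σ} (hp : p.NoConstantTerm)
    {f : σ → NatPoly τ} (hf : ∀ i, (f i).coeff 1 = 0) : (p.subst f).NoConstantTerm := by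
  have hlift {w : FreeMonoid σ} (hw : w ≠ 1) : (FreeMonoid.lift f w).coeff 1 = 0 := by
    induction w using FreeMonoid.casesOn with
    | one => exact absurd rfl hw
    | of_mul i w => rw [map_mul, coeff_one_mul, FreeMonoid.lift_eval_of, hf, zero_mul]
  simp only [NoConstantTerm, NCPolynomial.subst, Finsupp.finsetSum_apply, coeffMul_eq_coeffMulHom,
    coeffMulHom_apply]
  refine Finset.sum_eq_zero fun w hw => ?_
  rw [hlift, zero_nsmul]
  rintro rfl
  exact Finsupp.mem_support_iff.1 hw hp

theorem coeff_one_sum_natVar {ι : Type*} (s : Finset ι) (y : ι → τ) :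
    (∑ j ∈ s, (natVar (y j) : NatPoly τ)).coeff 1 = 0 := by
  rw [MonoidAlgebra.coeff_sum, Finsupp.finsetSum_apply]
  refine Finset.sum_eq_zero fun j _ => ?_
  rw [natVar, MonoidAlgebra.of_apply, MonoidAlgebra.coeff_single]
  exact Finsupp.single_eq_of_ne (FreeMonoid.of_ne_one _).symm

end NCPolynomial

open NCPolynomial in
theorem proposition7p3_general {ι κ σ G : Type*} [Finite ι] [Finite κ] [AddCommSemigroup G]
    (p : ι → NCPolynomial G σ) (hp : ∀ t, (p t).NoConstantTerm) :
    ∃ (N : ℕ) (Q : Finset (NCPolynomial G (σ × Fin N))),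
      (∀ f ∈ Q, f.NoConstantTerm) ∧
      ∀ χ : Q → κ, ∃ γ : Finset (Fin N), γ.Nonempty ∧ ∃ h, ∃ hh : h ∈ Q, ∀ t,
        ∃ hmem : h + (p t).subst (fun m => ∑ j ∈ γ, natVar (m, j)) ∈ Q,
          χ ⟨_, hmem⟩ = χ ⟨h, hh⟩ := by
  classical
  obtain ⟨N, Q, hQ⟩ := (isRecurrent_subst (σ × ℕ) hp).exists_finset_coloring (Set.finite_range _)
    κ fun j i => natVar (i, j)
  let g := Fin.ofNat (N + 1)
  -- Erasing constant terms affects `h`, but none of the `(p t).subst f` that are added to it.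
  let π : NCPolynomial G (σ × ℕ) →+ NCPolynomial G (σ × Fin (N + 1)) :=
    (Finsupp.eraseAddHom 1).comp (rename (Prod.map id g))
  refine ⟨N + 1, Q.image π, ?_, fun χ => ?_⟩
  · simp only [Finset.forall_mem_image]
    exact fun f _ => Finsupp.erase_same
  obtain ⟨γ, hγ, hγ₀, h, hh, hχ⟩ := hQ fun x => χ ⟨π x, Finset.mem_image_of_mem π x.2⟩
  have hg : Set.InjOn g γ := fun i hi j hj hij => Nat.ModEq.eq_of_lt_of_lt (congrArg Fin.val hij)
    (Nat.lt_succ_of_lt (Finset.mem_range.1 (hγ hi)))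
    (Nat.lt_succ_of_lt (Finset.mem_range.1 (hγ hj)))
  have hπ (t) : π ((p t).subst (∑ j ∈ γ, fun i => natVar (i, j))) =
      (p t).subst fun m => ∑ j ∈ γ.image g, natVar (m, j) := by
    have hterm : rename (Prod.map id g) ((p t).subst (∑ j ∈ γ, fun i => natVar (i, j))) =
        (p t).subst fun m => ∑ j ∈ γ.image g, natVar (m, j) := by
      simp only [rename_subst, Finset.sum_apply, map_sum, mapDomainRingHom_natVar,
        Finset.sum_image hg, Prod.map_apply, id_eq]
    rw [AddMonoidHom.comp_apply, hterm]
    exact Finsupp.erase_of_notMem_support <| Finsupp.notMem_support_iff.2 <|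
      (hp t).subst fun i => coeff_one_sum_natVar _ _
  refine ⟨γ.image g, hγ₀.image g, π h, Finset.mem_image_of_mem π hh, fun t => ?_⟩
  obtain ⟨hmem, hc⟩ := hχ _ ⟨t, rfl⟩
  simp only [← hπ, ← map_add]
  exact ⟨Finset.mem_image_of_mem π hmem, hc⟩

theorem proposition7p3 (r q n : ℕ) {G : Type*} [AddCommSemigroup G]
    (p : Fin q → NCPolynomial G (Fin n)) (hp : ∀ t, (p t).NoConstantTerm) :
    ∃ (N : ℕ) (Q : Finset (NCPolynomial G (Fin n × Fin N))),
      (∀ f ∈ Q, f.NoConstantTerm) ∧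
      ∀ χ : Q → Fin r, ∃ γ : Finset (Fin N), γ.Nonempty ∧ ∃ h ∈ Q, ∃ c : Fin r, ∀ t : Fin q,
        ∃ hmem : h + (p t).subst (fun m => ∑ j ∈ γ, NCPolynomial.natVar (m, j)) ∈ Q,
          χ ⟨h + (p t).subst (fun m => ∑ j ∈ γ, NCPolynomial.natVar (m, j)), hmem⟩ = c :=
  let ⟨N, Q, hQ, hχ⟩ := proposition7p3_general p hp
  ⟨N, Q, hQ, fun χ => let ⟨γ, hγ, h, hh, hc⟩ := hχ χ; ⟨γ, hγ, h, hh, χ ⟨h, hh⟩, hc⟩⟩
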